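/- Let $\Gamma$ be a group with a finite generating set $S$, let $\|g\|$ be the word length of $g\in\Gamma$ with respect to $S$, $d(g,h)=\|g^{-1}h\|$ the word distance and $\langle g,h\rangle=\tfrac12\bigl(\|g\|+\|h\|-d(g,h)\bigr)$ the Gromov product based at the identity. Assume that $\Gamma$ is hyperbolic, i.e. that there is $\delta$ with $\langle g,k\rangle\ge\min(\langle g,h\rangle,\langle h,k\rangle)-\delta$ for all $g,h,k\in\Gamma$. Let $[g]_\infty=\lim_{n\to\infty}\|g^n\|/n$ be the stable length of $g$. Then there exist $u,v\in\Gamma$ and a constant $\alpha$ such that for every $g\in\Gamma$ $$\|g\|\le 3\,\sup\bigl([g]_\infty,[gu]_\infty,[gv]_\infty\bigr)+\alpha .$$ Moreover, $\Gamma$ has the U-property (is undistorted in its conjugacy classes): $\Gamma$ is finitely generated and for each finite generating set, with word length $\|\cdot\|$ and translation length $\ell(\gamma)=\inf_{\eta\in\Gamma}\|\eta\gamma\eta^{-1}\|$, there exist finitely many elements $g_1,\dots,g_p\in\Gamma$ ($p\ge1$) and positive constants $A,B$ such that $\|\gamma\|\le A\sup_{1\le i\le p}\ell(g_i\gamma)+B$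 for all $\gamma\in\Gamma$. -/

import Mathlib

namespace HypGroup

variable {Γ : Type*} [Group Γ]

/-- The word length `‖g‖` of `g` with respect to the generating set `S`: the least length of a
word in the letters `s`, `s⁻¹` (`s ∈ S`) that represents `g`. -/
noncomputable def wordNorm (S : Set Γ) (g : Γ) : ℕ :=
  sInf {n : ℕ | ∃ l : List Γ, (∀ x ∈ l, x ∈ S ∨ x⁻¹ ∈ S) ∧ l.prod = g ∧ l.length = n}

/-- The (left-invariant) word distance, `d(g, h) = ‖g⁻¹h‖`. -/
noncomputable def wordDist (S : Set Γ) (g h : Γ) : ℝ := wordNorm S (g⁻¹ * h)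

/-- The Gromov product `⟨g, h⟩_u` based at `u`. -/
noncomputable def gromovProduct (S : Set Γ) (u g h : Γ) : ℝ :=
  (1 / 2) * (wordDist S g u + wordDist S h u - wordDist S g h)

/-- `δ`-hyperbolicity of `Γ` for the word distance of `S`, by Gromov products based at `1`. -/
def IsDeltaHyperbolic (S : Set Γ) (δ : ℝ) : Prop :=
  ∀ g h k : Γ,
    gromovProduct S 1 g k ≥ min (gromovProduct S 1 g h) (gromovProduct S 1 h k) - δ

/-- `Γ` is hyperbolic for the word distance of `S`. -/
def IsHyperbolic (S : Set Γ) : Prop := ∃ δ : ℝ, IsDeltaHyperbolic S δ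

/-- The stable length `[g]_∞ = lim ‖gⁿ‖ / n`; the limit exists whenever `S` generates `Γ`, see
`tendsto_stableLength`. -/
noncomputable def stableLength (S : Set Γ) (g : Γ) : ℝ :=
  Filter.limUnder Filter.atTop (fun n : ℕ => (wordNorm S (g ^ n) : ℝ) / n)

/-- The translation length `ℓ(g) = inf_η ‖η g η⁻¹‖`. -/
noncomputable def translationLength (S : Set Γ) (g : Γ) : ℕ :=
  ⨅ η : Γ, wordNorm S (η * g * η⁻¹)

/-- The inequality of the U-property for the word length of `S`: there are finitely many elements
`g₁, …, g_p` and positive constants `A`, `B` with `‖γ‖ ≤ A sup_i ℓ(g_i γ) + B` for all `γ`. -/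
def IsUndistortedInConjugacyClasses (S : Set Γ) : Prop :=
  ∃ (F : Finset Γ) (hF : F.Nonempty) (A B : ℝ), 0 < A ∧ 0 < B ∧
    ∀ γ : Γ, (wordNorm S γ : ℝ) ≤
      A * F.sup' hF (fun f => (translationLength S (f * γ) : ℝ)) + B

/-- The group `Γ` has the U-property: it is finitely generated, and the inequality holds for the
word length of each (equivalently, of some) finite generating set. -/
def HasUProperty (Γ : Type*) [Group Γ] : Prop :=
  Group.FG Γ ∧ ∀ S : Set Γ, S.Finite → Subgroup.closure S = ⊤ →
    IsUndistortedInConjugacyClasses S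

/-- If `S` generates `Γ`, the word length of `g` is realised by a word. -/
theorem exists_word {S : Set Γ} (hS : Subgroup.closure S = ⊤) (g : Γ) :
    ∃ l : List Γ, (∀ x ∈ l, x ∈ S ∨ x⁻¹ ∈ S) ∧ l.prod = g ∧ l.length = wordNorm S g := by
  have hne : {n : ℕ | ∃ l : List Γ,
      (∀ x ∈ l, x ∈ S ∨ x⁻¹ ∈ S) ∧ l.prod = g ∧ l.length = n}.Nonempty := by
    have hg : g ∈ (Subgroup.closure S).toSubmonoid := by rw [hS]; trivial
    rw [Subgroup.closure_toSubmonoid] at hg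
    obtain ⟨l, hl, hp⟩ := Submonoid.exists_list_of_mem_closure hg
    exact ⟨l.length, l, fun x hx => by simpa using hl x hx, hp, rfl⟩
  exact Nat.sInf_mem hne

theorem wordNorm_mul_le {S : Set Γ} (hS : Subgroup.closure S = ⊤) (g h : Γ) :
    wordNorm S (g * h) ≤ wordNorm S g + wordNorm S h := by
  obtain ⟨l, hl, hp, hn⟩ := exists_word hS g
  obtain ⟨l', hl', hp', hn'⟩ := exists_word hS h
  refine Nat.sInf_le ⟨l ++ l', fun x hx => ?_, by simp [hp, hp'], by simp [hn, hn']⟩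
  rcases List.mem_append.1 hx with hx | hx
  · exact hl x hx
  · exact hl' x hx

/-- If `S` generates `Γ`, the limit that defines the stable length exists. -/
theorem tendsto_stableLength {S : Set Γ} (hS : Subgroup.closure S = ⊤) (g : Γ) :
    Filter.Tendsto (fun n : ℕ => (wordNorm S (g ^ n) : ℝ) / n) Filter.atTop
      (nhds (stableLength S g)) := by
  have hsub : Subadditive (fun n : ℕ => (wordNorm S (g ^ n) : ℝ)) := fun m n => by
    simp only [pow_add]; exact_mod_cast wordNorm_mul_le hS _ _
  have h := hsub.tendsto_lim ⟨0, by rintro _ ⟨n, rfl⟩; positivity⟩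
  exact tendsto_nhds_limUnder ⟨_, h⟩

end HypGroup

/-! If the Gromov product of `g⁻¹` and `g` is small against `‖g‖`, the powers of `g` form a
quasi-geodesic and `[g]_∞ ≥ ‖g‖ - 2⟨g⁻¹, g⟩ - 2δ` (`mul_le_pow`). It therefore suffices to find `u`,
`v` such that one of `g`, `gu`, `gv` has bounded cancellation in its square.

Suppose `Γ` is infinite; some `h` then has an axis (`exists_two_gp_add_lt`). The heart is
`exists_gp_le`: for some `v`, no `x` can have `x⁻¹` close to `x` while `h` and `v` both almost fix
the direction of `x`. Otherwise every `v` would almost fix an end of the axis, hence stay at bounded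
distance from `⟨h⟩` and commute with a fixed power of `h`. All of `Γ` would then be a central cyclic
subgroup up to a bounded error, and there `x⁻¹` and `x` point to opposite ends. Taking `x = g⁻¹`
gives the inequality with multipliers `h⁻¹` and `v⁻¹`, even with 1 in place of 3.

The U-property follows because the stable length is at most the length of every conjugate, and word
lengths are Lipschitz equivalent. -/

namespace HypGroup

open Filter

/-- The Gromov product at `1` for the left-invariant distance of a length function `N`. -/
noncomputable def gp {Γ : Type*} [Group Γ] (N : Γ → ℝ) (a b : Γ) : ℝ :=
  (N a + N b - N (a⁻¹ * b)) / 2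

/-- A symmetric length function whose left-invariant distance is `δ`-hyperbolic. -/
structure IsHypLength {Γ : Type*} [Group Γ] (N : Γ → ℝ) (δ : ℝ) : Prop where
  one : N 1 = 0
  inv : ∀ g, N g⁻¹ = N g
  mul_le : ∀ g h, N (g * h) ≤ N g + N h
  hyp : ∀ a b c, min (gp N a b) (gp N b c) - δ ≤ gp N a c

/-! ### Gromov products and the growth of powers -/

namespace IsHypLength

variable {Γ : Type*} [Group Γ] {N : Γ → ℝ} {δ : ℝ}

theorem delta_nonneg (hN : IsHypLength N δ) : 0 ≤ δ := by
  have := hN.hyp 1 1 1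
  simp only [min_self] at this
  linarith

theorem nonneg (hN : IsHypLength N δ) (g : Γ) : 0 ≤ N g := by
  have := hN.mul_le g g⁻¹
  rw [mul_inv_cancel, hN.one, hN.inv] at this
  linarith

theorem inv_mul_comm (hN : IsHypLength N δ) (a b : Γ) : N (a⁻¹ * b) = N (b⁻¹ * a) := by
  rw [← hN.inv]; simp

theorem gp_comm (hN : IsHypLength N δ) (a b : Γ) : gp N a b = gp N b a := by
  simp only [gp, hN.inv_mul_comm a b]; ring

theorem gp_le_left (hN : IsHypLength N δ) (a b : Γ) : gp N a b ≤ N a := by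
  have := hN.mul_le a (a⁻¹ * b)
  rw [mul_inv_cancel_left] at this
  simp only [gp]; linarith

theorem gp_nonneg (hN : IsHypLength N δ) (a b : Γ) : 0 ≤ gp N a b := by
  have := hN.mul_le a⁻¹ b
  rw [hN.inv] at this
  simp only [gp]; linarith

theorem gp_self (hN : IsHypLength N δ) (a : Γ) : gp N a a = N a := by
  simp [gp, hN.one]

theorem gp_one_right (hN : IsHypLength N δ) (a : Γ) : gp N a 1 = 0 := by
  simp [gp, hN.one, hN.inv]

/-- In the triangle `1, a, b`, the Gromov products based at the two ends of the side from `1` to `a`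
add up to its length; the one based at `a` is translated to `1`. -/
theorem gp_eq_sub (hN : IsHypLength N δ) (a b : Γ) :
    gp N a b = N a - gp N a⁻¹ (a⁻¹ * b) := by
  simp only [gp, hN.inv, inv_inv, mul_inv_cancel_left]; ring

theorem le_mul (hN : IsHypLength N δ) (a b : Γ) : N a - N b ≤ N (a * b) := by
  have := hN.mul_le (a * b) b⁻¹
  rw [mul_inv_cancel_right, hN.inv] at this
  linarith

theorem le_mul' (hN : IsHypLength N δ) (a b : Γ) : N b - N a ≤ N (a * b) := by
  have := hN.mul_le a⁻¹ (a * b)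
  rw [inv_mul_cancel_left, hN.inv] at this
  linarith

theorem gp_sub_le_gp_mul_left (hN : IsHypLength N δ) (g a b : Γ) :
    gp N a b - N g ≤ gp N (g * a) (g * b) := by
  have h1 := hN.le_mul' g a
  have h2 := hN.le_mul' g b
  have : (g * a)⁻¹ * (g * b) = a⁻¹ * b := by group
  simp only [gp, this]; linarith

theorem gp_sub_le_gp_mul_right (hN : IsHypLength N δ) (a b c : Γ) :
    gp N a b - N c ≤ gp N a (b * c) := by
  have h1 := hN.le_mul b c
  have h2 := hN.mul_le (a⁻¹ * b) c
  rw [mul_assoc] at h2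
  simp only [gp]; linarith

theorem gp_mul_right_le (hN : IsHypLength N δ) (a b c : Γ) :
    gp N a (b * c) ≤ gp N a b + N c := by
  have := hN.gp_sub_le_gp_mul_right a (b * c) c⁻¹
  rw [mul_inv_cancel_right, hN.inv] at this
  linarith

theorem le_gp (hN : IsHypLength N δ) {a b c : Γ} {t : ℝ} (h1 : t ≤ gp N a b)
    (h2 : t ≤ gp N b c) : t - δ ≤ gp N a c :=
  (sub_le_sub_right (le_min h1 h2) δ).trans (hN.hyp a b c)

theorem pow_le (hN : IsHypLength N δ) (h : Γ) (n : ℕ) : N (h ^ n) ≤ n * N h := by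
  induction n with
  | zero => simp [hN.one]
  | succ n ih =>
    have := hN.mul_le (h ^ n) h
    rw [← pow_succ] at this
    push_cast; linarith

/-- By induction, `h⁻⁽ⁿ⁺¹⁾` follows `h⁻¹` for longer than `⟨h⁻¹, h⟩ + δ`, so it must leave `h` about
where `h⁻¹` does. -/
theorem gp_pow_inv_self_le (hN : IsHypLength N δ) {h : Γ}
    (hL : 2 * gp N h⁻¹ h + 2 * δ < N h) (n : ℕ) :
    gp N (h ^ n)⁻¹ h ≤ gp N h⁻¹ h + δ := by
  have hδ := hN.delta_nonneg
  have hc := hN.gp_nonneg h⁻¹ h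
  induction n with
  | zero =>
    rw [pow_zero, inv_one, hN.gp_comm, hN.gp_one_right]; linarith
  | succ n ih =>
    by_contra! hcon
    have e : h⁻¹⁻¹ * (h ^ (n + 1))⁻¹ = (h ^ n)⁻¹ := by rw [pow_succ]; group
    have h1 := hN.gp_eq_sub h⁻¹ (h ^ (n + 1))⁻¹
    rw [e, inv_inv, hN.inv, hN.gp_comm h] at h1
    rcases min_le_iff.1 (sub_le_iff_le_add.1 (hN.hyp h⁻¹ (h ^ (n + 1))⁻¹ h)) with h2 | h2 <;>
      linarith

theorem mul_le_pow (hN : IsHypLength N δ) {h : Γ}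
    (hL : 2 * gp N h⁻¹ h + 2 * δ < N h) (n : ℕ) :
    n * (N h - 2 * gp N h⁻¹ h - 2 * δ) ≤ N (h ^ n) := by
  induction n with
  | zero => simp [hN.one]
  | succ n ih =>
    have h1 := hN.gp_pow_inv_self_le hL n
    rw [gp, inv_inv, ← pow_succ, hN.inv] at h1
    push_cast; linarith

theorem gp_inv_pow_pow_le (hN : IsHypLength N δ) {h : Γ}
    (hL : 2 * gp N h⁻¹ h + 3 * δ < N h) (m n : ℕ) :
    gp N (h ^ m)⁻¹ (h ^ n) ≤ gp N h⁻¹ h + 2 * δ := by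
  have hδ := hN.delta_nonneg
  have hc := hN.gp_nonneg h⁻¹ h
  cases n with
  | zero => rw [pow_zero, hN.gp_one_right]; linarith
  | succ n =>
    have h1 := hN.gp_pow_inv_self_le (h := h) (by linarith) m
    have h2 := hN.gp_pow_inv_self_le (h := h⁻¹)
      (by rw [inv_inv, hN.inv, hN.gp_comm]; linarith) n
    rw [inv_pow, inv_inv, inv_inv, hN.gp_comm h] at h2
    have h3 := hN.gp_eq_sub h (h ^ (n + 1))
    have e : h⁻¹ * h ^ (n + 1) = h ^ n := by rw [pow_succ']; group
    rw [e, hN.gp_comm, hN.gp_comm h⁻¹] at h3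
    by_contra! hcon
    rcases min_le_iff.1 (sub_le_iff_le_add.1 (hN.hyp (h ^ m)⁻¹ (h ^ (n + 1)) h)) with h4 | h4 <;>
      linarith

/-- A space with long geodesics has elements with little cancellation in their squares. -/
theorem exists_two_gp_add_lt (hN : IsHypLength N δ)
    (hgeo : ∀ n : ℕ, ∃ g h : Γ, N g = n ∧ N h = n ∧ N (g * h) = 2 * n) (D : ℝ) :
    ∃ g, 2 * gp N g⁻¹ g + D < N g := by
  by_contra! hcon
  have hδ := hN.delta_nonneg
  obtain ⟨n, hn⟩ := exists_nat_gt (max D 0 + 8 * δ)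
  have hD := le_max_left D 0
  have hD0 := le_max_right D 0
  obtain ⟨g, h, hg, hh, hgh⟩ := hgeo n
  have c1 := hcon g
  have c2 := hcon h
  have c3 := hcon (g * h)
  rw [hg] at c1; rw [hh] at c2; rw [hgh] at c3
  have e1 : gp N g (g * h) = n := by
    rw [gp, inv_mul_cancel_left, hg, hgh, hh]; ring
  have e2 : gp N (g * h)⁻¹ h⁻¹ = n := by
    rw [gp, hN.inv, hN.inv, inv_inv, mul_inv_cancel_right, hg, hgh, hh]; ring
  have e3 : gp N g⁻¹ h = 0 := by
    rw [gp, hN.inv, inv_inv, hg, hgh, hh]; ring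
  -- If all squares cancel, the chain `g⁻¹, g, gh, (gh)⁻¹, h⁻¹, h` has consecutive products of at
  -- least about `n / 2`. Its four uses of hyperbolicity cost `4δ`, whence the `8δ` in the choice of
  -- `n`; but `⟨g⁻¹, h⟩ = 0`.
  have a1 := hN.le_gp (t := n - max D 0 / 2) (a := g) (b := g * h) (c := (g * h)⁻¹)
    (by linarith) (by rw [hN.gp_comm]; linarith)
  have a2 := hN.le_gp (t := n - max D 0 / 2 - δ) a1 (c := h⁻¹) (by linarith)
  have a3 := hN.le_gp (t := n / 2 - max D 0 / 2 - 2 * δ) (a := g⁻¹) (b := g) (c := h⁻¹)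
    (by linarith) (by linarith)
  have a4 := hN.le_gp (t := n / 2 - max D 0 / 2 - 3 * δ) (a := g⁻¹) (b := h⁻¹) (c := h)
    (by linarith) (by linarith)
  linarith

theorem le_gp_pow_mul (hN : IsHypLength N δ) (g x : Γ) (n : ℕ) :
    gp N x (g * x) - n * (N g + δ) ≤ gp N x (g ^ n * x) := by
  have hδ := hN.delta_nonneg
  induction n with
  | zero =>
    have := hN.gp_le_left x (g * x)
    simpa [hN.gp_self] using this
  | succ n ih =>
    have h1 := hN.gp_sub_le_gp_mul_left g x (g ^ n * x)
    rw [← mul_assoc, ← pow_succ'] at h1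
    have h0 : 0 ≤ n * (N g + δ) := by have := hN.nonneg g; positivity
    have h0' := hN.nonneg g
    have := hN.le_gp (t := gp N x (g * x) - n * (N g + δ) - N g) (a := x) (b := g * x)
      (c := g ^ (n + 1) * x) (by linarith) (by linarith)
    push_cast; linarith

end IsHypLength

/-- The powers of `h` form a quasi-geodesic: the two ends have bounded Gromov product
and the lengths of the powers grow at least linearly. -/
structure IsAxis {Γ : Type*} [Group Γ] (N : Γ → ℝ) (C a : ℝ) (h : Γ) : Prop where
  gp_le : ∀ m n : ℕ, gp N (h ^ m)⁻¹ (h ^ n) ≤ C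
  pos : 0 < a
  le_pow : ∀ n : ℕ, n * a ≤ N (h ^ n)

/-! ### Points near an axis -/

namespace IsAxis

variable {Γ : Type*} [Group Γ] {N : Γ → ℝ} {δ C a : ℝ} {h : Γ}

theorem inv (hN : IsHypLength N δ) (hh : IsAxis N C a h) : IsAxis N C a h⁻¹ where
  gp_le m n := by
    rw [inv_pow, inv_inv, inv_pow, hN.gp_comm]; exact hh.gp_le n m
  pos := hh.pos
  le_pow n := by rw [inv_pow, hN.inv]; exact hh.le_pow n

theorem nonneg (hN : IsHypLength N δ) (hh : IsAxis N C a h) : 0 ≤ C :=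
  (hN.gp_nonneg _ _).trans (hh.gp_le 0 0)

theorem tendsto (hh : IsAxis N C a h) : Tendsto (fun n : ℕ => N (h ^ n)) atTop atTop :=
  tendsto_atTop_mono hh.le_pow (tendsto_natCast_atTop_atTop.atTop_mul_const hh.pos)

theorem sub_le_gp_pow (hN : IsHypLength N δ) (hh : IsAxis N C a h) {k n : ℕ} (hkn : k ≤ n) :
    N (h ^ k) - C ≤ gp N (h ^ k) (h ^ n) := by
  have e : (h ^ k)⁻¹ * h ^ n = h ^ (n - k) := by
    rw [inv_mul_eq_iff_eq_mul, ← pow_add, Nat.add_sub_cancel' hkn]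
  rw [hN.gp_eq_sub, e]
  linarith [hh.gp_le k (n - k)]

/-- The hypothesis puts `y` near a geodesic from `1` to `h ^ n`. The first power of length at least
`N y - 2 * C'` has about the length of `y`, since lengths grow by at most `N h` per step, and both
point towards `h ^ n`. -/
theorem exists_near (hN : IsHypLength N δ) (hh : IsAxis N C a h) {C' : ℝ} {n : ℕ} {y : Γ}
    (hy : gp N y⁻¹ (y⁻¹ * h ^ n) ≤ C') :
    ∃ m : ℕ, N ((h ^ m)⁻¹ * y) ≤ N h + 4 * C' + 2 * C + 2 * δ := by
  classical
  have hδ := hN.delta_nonneg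
  have hC := hh.nonneg hN
  have hC' : 0 ≤ C' := (hN.gp_nonneg _ _).trans hy
  have hL := hN.nonneg h
  have h1 := hN.gp_eq_sub y (h ^ n)
  have hex : ∃ m, N y - 2 * C' ≤ N (h ^ m) := by
    refine ⟨n, ?_⟩
    have := hN.gp_le_left (h ^ n) y
    rw [hN.gp_comm] at this
    linarith
  have hm1 := Nat.find_spec hex
  have hmn : Nat.find hex ≤ n := Nat.find_min' hex (by
    have := hN.gp_le_left (h ^ n) y
    rw [hN.gp_comm] at this
    linarith)
  have hm2 : N (h ^ Nat.find hex) ≤ N y + N h := by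
    rcases Nat.eq_zero_or_pos (Nat.find hex) with h0 | h0
    · rw [h0, pow_zero, hN.one]; linarith [hN.nonneg y]
    · have := Nat.find_min hex (Nat.sub_lt h0 one_pos)
      have h2 := hN.mul_le (h ^ (Nat.find hex - 1)) h
      rw [← pow_succ, Nat.sub_add_cancel h0] at h2
      linarith
  generalize Nat.find hex = m at hm1 hm2 hmn
  refine ⟨m, ?_⟩
  have h3 := hh.sub_le_gp_pow hN hmn
  have h4 := hN.hyp y (h ^ n) (h ^ m)
  rw [hN.gp_comm (h ^ n)] at h4
  rw [hN.inv_mul_comm]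
  have h5 : N (y⁻¹ * h ^ m) = N y + N (h ^ m) - 2 * gp N y (h ^ m) := by rw [gp]; ring
  rcases min_le_iff.1 (sub_le_iff_le_add.1 h4) with h6 | h6 <;> linarith

/-- If `v` almost fixes the end of the axis, it maps far points of the axis close to it. -/
theorem exists_near_mul_pow (hN : IsHypLength N δ) (hh : IsAxis N C a h) {v : Γ} {E : ℝ}
    (hv : ∃ᶠ n in atTop, N (h ^ n) - E ≤ gp N (h ^ n) (v * h ^ n)) {k : ℕ}
    (hk : N v + C + 2 * δ < N (h ^ k)) :
    ∃ m : ℕ, N ((h ^ m)⁻¹ * (v * h ^ k)) ≤ N h + 6 * C + 10 * δ := by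
  have hδ := hN.delta_nonneg
  have hev : ∀ᶠ n in atTop, E + N v + N (h ^ k) + C + 2 * δ < N (h ^ n) :=
    hh.tendsto.eventually_gt_atTop _
  obtain ⟨n, hn1, hn2, hkn⟩ := (hv.and_eventually (hev.and (eventually_ge_atTop k))).exists
  set y := v * h ^ k with hy
  -- Seen from `y`, the points `v` and `v * h ^ n` lie in the opposite directions `h⁻ᵏ` and `h ^ (n
  -- - k)`. Replacing them by `1` and `h ^ n` costs one `δ` each.
  suffices hs : gp N y⁻¹ (y⁻¹ * h ^ n) ≤ C + 2 * δ by
    obtain ⟨m, hm⟩ := hh.exists_near hN hs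
    exact ⟨m, by linarith⟩
  have hNy : N y ≤ N v + N (h ^ k) := hN.mul_le _ _
  have e1 : y⁻¹ * (v * h ^ n) = h ^ (n - k) := by
    rw [inv_mul_eq_iff_eq_mul, hy, mul_assoc, ← pow_add, Nat.add_sub_cancel' hkn]
  have e2 : y⁻¹ * v = (h ^ k)⁻¹ := by rw [hy]; group
  have b1 := hN.gp_sub_le_gp_mul_left y⁻¹ (h ^ n) (v * h ^ n)
  rw [e1, hN.inv] at b1
  have b2 : N (h ^ k) - N v ≤ gp N (h ^ k)⁻¹ y⁻¹ := by
    have := hN.gp_sub_le_gp_mul_right y⁻¹ y⁻¹ v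
    rw [e2, hN.gp_self, hN.inv, hN.gp_comm] at this
    have h3 := hN.le_mul' v (h ^ k)
    rw [gp]
    have e3 : (h ^ k)⁻¹⁻¹ * y⁻¹ = v⁻¹ := by rw [hy]; group
    rw [e3, hN.inv, hN.inv, hN.inv]
    linarith
  have b3 := hh.gp_le k (n - k)
  by_contra! hcon
  have c1 := hN.hyp (h ^ k)⁻¹ y⁻¹ (y⁻¹ * h ^ n)
  have c2 := hN.hyp (h ^ k)⁻¹ (y⁻¹ * h ^ n) (h ^ (n - k))
  rcases min_le_iff.1 (sub_le_iff_le_add.1 c1) with h6 | h6 <;>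
  rcases min_le_iff.1 (sub_le_iff_le_add.1 c2) with h7 | h7 <;> linarith

end IsAxis

end HypGroup
namespace HypGroup

open Filter

/-! ### Elements that almost fix an end of the axis -/

namespace IsAxis

variable {Γ : Type*} [Group Γ] {N : Γ → ℝ} {δ C a : ℝ} {h : Γ}

/-- Pigeonhole: the elements `h⁻ᵐ v hᵏ` with `hᵐ` near `v hᵏ` lie in a finite ball, so two of them
coincide. The bound on `j` does not depend on `v`. -/
theorem exists_conj_pow_eq_zpow (hN : IsHypLength N δ) (hh : IsAxis N C a h)
    (hfin : {g | N g ≤ N h + 6 * C + 10 * δ}.Finite) {v : Γ} {E : ℝ}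
    (hv : ∃ᶠ n in atTop, N (h ^ n) - E ≤ gp N (h ^ n) (v * h ^ n)) :
    ∃ j : ℕ, 0 < j ∧ j ≤ hfin.toFinset.card ∧ ∃ i : ℤ, v * h ^ j * v⁻¹ = h ^ i := by
  obtain ⟨k₀, hk₀⟩ := eventually_atTop.1 (hh.tendsto.eventually_gt_atTop (N v + C + 2 * δ))
  choose m hm using fun k : ℕ => hh.exists_near_mul_pow hN hv (hk₀ (k₀ + k) (by omega))
  obtain ⟨x, hx, y, hy, hxy, he⟩ := Finset.exists_ne_map_eq_of_card_lt_of_maps_to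
    (s := Finset.range (hfin.toFinset.card + 1)) (t := hfin.toFinset)
    (f := fun k => (h ^ m k)⁻¹ * (v * h ^ (k₀ + k))) (by simp)
    (fun k _ => by simpa using hm k)
  wlog hlt : x < y generalizing x y
  · exact this y hy x hx hxy.symm he.symm (by omega)
  simp only [Finset.mem_range] at hx hy
  refine ⟨y - x, by omega, by omega, (m y : ℤ) - m x, ?_⟩
  have e1 : h ^ (k₀ + y) = h ^ (y - x) * h ^ (k₀ + x) := by rw [← pow_add]; congr 1; omega
  have e2 : v * h ^ (k₀ + y) = h ^ m y * ((h ^ m x)⁻¹ * (v * h ^ (k₀ + x))) :=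
    (inv_mul_eq_iff_eq_mul.1 he.symm)
  rw [e1] at e2
  have e3 : v * h ^ (y - x) = h ^ m y * (h ^ m x)⁻¹ * v :=
    mul_right_cancel (b := h ^ (k₀ + x)) (by simpa only [mul_assoc] using e2)
  rw [e3, mul_inv_cancel_right, zpow_sub, zpow_natCast, zpow_natCast]

theorem le_of_forall_pow_le (hN : IsHypLength N δ) (hh : IsAxis N C a h) {j i : ℕ} {D : ℝ}
    (hD : ∀ q : ℕ, N (h ^ (i * q)) ≤ N (h ^ (j * q)) + D) : i ≤ j := by
  by_contra! hlt
  obtain ⟨q, hq⟩ := exists_nat_gt ((D + 2 * C) / a)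
  rw [div_lt_iff₀ hh.pos] at hq
  have h1 := hh.gp_le (j * q) ((i - j) * q)
  have e : j * q + (i - j) * q = i * q := by rw [← add_mul]; congr 1; omega
  rw [gp, inv_inv, ← pow_add, e, hN.inv] at h1
  have h2 := hh.le_pow ((i - j) * q)
  have h3 : (q : ℝ) ≤ ((i - j) * q : ℕ) := by
    exact_mod_cast Nat.le_mul_of_pos_left q (by omega)
  nlinarith [hD q, hh.pos]

/-- Conjugation by `v` changes lengths by at most `2 * N v`, so linear growth forces `|i| = j`; the
sign `-` would make `v` exchange the two ends. -/
theorem commute_of_conj_pow_eq_zpow (hN : IsHypLength N δ) (hh : IsAxis N C a h) {v : Γ} {E : ℝ}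
    (hv : ∃ᶠ n in atTop, N (h ^ n) - E ≤ gp N (h ^ n) (v * h ^ n)) {j : ℕ} (hj : 0 < j)
    {i : ℤ} (he : v * h ^ j * v⁻¹ = h ^ i) : Commute v (h ^ j) := by
  have hpow (q : ℕ) : v * h ^ (j * q) * v⁻¹ = h ^ (i * q) := by
    rw [zpow_mul, ← he, zpow_natCast, conj_pow, pow_mul]
  have habs (q : ℕ) : N (h ^ (i * q)) = N (h ^ (i.natAbs * q)) := by
    rcases Int.natAbs_eq i with hi | hi
    · conv_lhs => rw [hi]
      rw [← Nat.cast_mul, zpow_natCast]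
    · conv_lhs => rw [hi]
      rw [neg_mul, zpow_neg, ← Nat.cast_mul, zpow_natCast, hN.inv]
  have hij : i.natAbs = j := by
    apply le_antisymm
    · refine hh.le_of_forall_pow_le hN (D := 2 * N v) fun q => ?_
      rw [← habs, ← hpow]
      have h1 := hN.mul_le (v * h ^ (j * q)) v⁻¹
      have h2 := hN.mul_le v (h ^ (j * q))
      rw [hN.inv] at h1
      linarith
    · refine hh.le_of_forall_pow_le hN (D := 2 * N v) fun q => ?_
      rw [← habs, ← hpow]
      have h1 := hN.le_mul (v * h ^ (j * q)) v⁻¹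
      have h2 := hN.le_mul' v (h ^ (j * q))
      rw [hN.inv] at h1
      linarith
  rcases Int.natAbs_eq i with hi | hi
  · rw [hi, hij, zpow_natCast] at he
    exact mul_inv_eq_iff_eq_mul.1 he
  exfalso
  rw [hij] at hi
  subst hi
  -- Division of `n` by `j` puts `v * h ^ n` at bounded distance from a negative power of `h`, so
  -- its product with `h ^ n` is bounded, against `hv`.
  have hev := hh.tendsto.eventually_gt_atTop (E + C + N v + j * N h)
  obtain ⟨n, hn1, hn2⟩ := (hv.and_eventually hev).exists
  have e : v * h ^ n = (h ^ (j * (n / j)))⁻¹ * (v * h ^ (n % j)) := by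
    have h1 := hpow (n / j)
    rw [neg_mul, ← Nat.cast_mul, zpow_neg, zpow_natCast, mul_inv_eq_iff_eq_mul] at h1
    rw [← mul_assoc, ← h1, mul_assoc, ← pow_add, Nat.div_add_mod]
  rw [e] at hn1
  have h1 := hN.gp_mul_right_le (h ^ n) (h ^ (j * (n / j)))⁻¹ (v * h ^ (n % j))
  have h2 := hh.gp_le (j * (n / j)) n
  rw [hN.gp_comm] at h2
  have h3 := hN.mul_le v (h ^ (n % j))
  have h4 := hN.pow_le h (n % j)
  have h5 : ((n % j : ℕ) : ℝ) * N h ≤ j * N h :=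
    mul_le_mul_of_nonneg_right (by exact_mod_cast (Nat.mod_lt n hj).le) (hN.nonneg h)
  linarith

/-- The factorial is a multiple of every possible `j`, which makes the exponent independent of `v`.
-/
theorem commute_and_exists_near (hN : IsHypLength N δ) (hh : IsAxis N C a h)
    (hfin : {g | N g ≤ N h + 6 * C + 10 * δ}.Finite) {v : Γ} {E : ℝ}
    (hv : ∃ᶠ n in atTop, N (h ^ n) - E ≤ gp N (h ^ n) (v * h ^ n)) :
    Commute v (h ^ (hfin.toFinset.card).factorial) ∧
      ∃ i : ℤ, N (h ^ i * v) ≤ N h + 6 * C + 10 * δ := by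
  obtain ⟨j, hj0, hj, i, hi⟩ := hh.exists_conj_pow_eq_zpow hN hfin hv
  have hc := hh.commute_of_conj_pow_eq_zpow hN hv hj0 hi
  generalize hfin.toFinset.card = M at *
  refine ⟨?_, ?_⟩
  · obtain ⟨q, hq⟩ := Nat.dvd_factorial hj0 hj
    rw [hq, pow_mul]
    exact hc.pow_right q
  · obtain ⟨k, hk⟩ := eventually_atTop.1 (hh.tendsto.eventually_gt_atTop (N v + C + 2 * δ))
    obtain ⟨m, hm⟩ := hh.exists_near_mul_pow hN hv (hk (j * k) (Nat.le_mul_of_pos_left k hj0))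
    refine ⟨-(m : ℤ) + (j * k : ℕ), ?_⟩
    rw [pow_mul, (hc.pow_right k).eq, ← pow_mul, ← mul_assoc] at hm
    rwa [zpow_add, zpow_neg, zpow_natCast, zpow_natCast]

/-- A point almost fixed by `h` and `v` lies near one of the ends of the axis of `h`,
so that `v` almost fixes this end. -/
theorem sub_le_gp_pow_mul (hN : IsHypLength N δ) (hh : IsAxis N C a h) (v x : Γ) (n : ℕ)
    (hx : (n + 1) * (N h + δ) + N (h ^ n) ≤ gp N x (h * x))
    (hvx : N (h ^ n) ≤ gp N x (v * x)) (hs : gp N x (h ^ n) ≤ C + δ) :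
    N (h ^ n) - (C + N v + 4 * δ) ≤ gp N (h ^ n)⁻¹ (v * (h ^ n)⁻¹) := by
  have hδ := hN.delta_nonneg
  have hC := hh.nonneg hN
  have e1 : N ((h ^ n)⁻¹ * x) = N (x⁻¹ * h ^ n) := hN.inv_mul_comm _ _
  have h1 : N (h ^ n) - C - δ ≤ gp N (h ^ n)⁻¹ ((h ^ n)⁻¹ * x) := by
    rw [gp] at hs
    rw [gp, inv_inv, mul_inv_cancel_left, e1, hN.inv]
    linarith
  have h2 : N (h ^ n) ≤ gp N x ((h ^ n)⁻¹ * x) := by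
    have h3 := hN.le_gp_pow_mul h⁻¹ x n
    have h4 := hN.gp_sub_le_gp_mul_left h⁻¹ (h * x) x
    rw [inv_mul_cancel_left, hN.gp_comm, hN.inv] at h4
    rw [inv_pow, hN.inv] at h3
    linarith
  have h3 := hN.le_gp (t := N (h ^ n) - C - δ) (b := (h ^ n)⁻¹ * x) h1
    (c := x) (by rw [hN.gp_comm]; linarith)
  have h4 := hN.gp_sub_le_gp_mul_left v x (h ^ n)⁻¹
  rw [hN.gp_comm x] at h4
  have hv0 := hN.nonneg v
  have h5 := hN.le_gp (t := N (h ^ n) - C - 2 * δ) (a := (h ^ n)⁻¹) (b := x) (c := v * x)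
    (by linarith) (by linarith)
  have h6 := hN.le_gp (t := N (h ^ n) - C - 3 * δ - N v) (a := (h ^ n)⁻¹) (b := v * x)
    (c := v * (h ^ n)⁻¹) (by linarith) (by linarith)
  linarith

/-- A point `x` cannot be close to both `h ^ n` and `h⁻ⁿ`. The end it is close to may vary with `n`,
but one of the two occurs infinitely often. -/
theorem frequently_or (hN : IsHypLength N δ) (hh : IsAxis N C a h) (v : Γ)
    (H : ∀ K : ℝ, ∃ x, K < gp N x (h * x) ∧ K < gp N x (v * x)) :
    ∃ E : ℝ, (∃ᶠ n in atTop, N (h ^ n) - E ≤ gp N (h ^ n) (v * h ^ n)) ∨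
      ∃ᶠ n in atTop, N (h⁻¹ ^ n) - E ≤ gp N (h⁻¹ ^ n) (v * h⁻¹ ^ n) := by
  refine ⟨C + N v + 4 * δ, frequently_or_distrib.1 (Eventually.frequently ?_)⟩
  refine Eventually.of_forall fun n => ?_
  have hδ := hN.delta_nonneg
  obtain ⟨x, hx1, hx2⟩ := H ((n + 1) * (N h + δ) + N (h ^ n) + N h)
  have h0 : 0 ≤ (n + 1) * (N h + δ) := by have := hN.nonneg h; positivity
  have hL := hN.nonneg h
  have h1 := hN.hyp (h ^ n)⁻¹ x (h ^ n)
  have h2 := hh.gp_le n n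
  rcases min_le_iff.1 (sub_le_iff_le_add.1 h1) with h3 | h3
  · left
    have e : (h⁻¹ ^ n)⁻¹ = h ^ n := by rw [inv_pow, inv_inv]
    have h4 := (hh.inv hN).sub_le_gp_pow_mul hN v x n
    rw [e, inv_pow, hN.inv, hN.inv] at h4
    refine h4 ?_ (by linarith) (by rw [hN.gp_comm]; linarith)
    have h5 := hN.gp_sub_le_gp_mul_left h⁻¹ (h * x) x
    rw [inv_mul_cancel_left, hN.gp_comm, hN.inv] at h5
    linarith
  · right
    rw [inv_pow, hN.inv]
    exact hh.sub_le_gp_pow_mul hN v x n (by linarith) (by linarith) (by linarith)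

theorem exists_gp_le (hN : IsHypLength N δ) (hh : IsAxis N C a h)
    (hfin : ∀ r, {g | N g ≤ r}.Finite) :
    ∃ v : Γ, ∃ K : ℝ, ∀ x : Γ,
      gp N x⁻¹ x ≤ K ∨ gp N x (h * x) ≤ K ∨ gp N x (v * x) ≤ K := by
  by_contra! H
  obtain ⟨M, hM⟩ : ∃ M : ℕ, 0 < M ∧ ∀ v : Γ, Commute v (h ^ M) ∧
      ∃ i : ℤ, N (h ^ i * v) ≤ N h + 6 * C + 10 * δ := by
    have hf := hfin (N h + 6 * C + 10 * δ)
    refine ⟨_, Nat.factorial_pos hf.toFinset.card, fun v => ?_⟩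
    obtain ⟨E, hE | hE⟩ := hh.frequently_or hN v fun K => by
      obtain ⟨x, -, h1⟩ := H v K
      exact ⟨x, h1⟩
    · exact hh.commute_and_exists_near hN hf hE
    · have hf' : {g | N g ≤ N h⁻¹ + 6 * C + 10 * δ}.Finite := by rwa [hN.inv]
      obtain ⟨h1, i, h2⟩ := (hh.inv hN).commute_and_exists_near hN hf' hE
      simp only [hN.inv] at h1 h2
      rw [inv_pow] at h1
      exact ⟨by simpa using h1.inv_right, -i, by rwa [zpow_neg, ← inv_zpow]⟩
  obtain ⟨hM0, hM⟩ := hM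
  -- Only the product of `x⁻¹` and `x` matters now. Writing `x = w ^ q * b` with `b` bounded and `w
  -- ^ q` commuting with `x`, it is at most `C + 2 * N b`.
  obtain ⟨x, hx, -⟩ := H 1 (C + 2 * (N h + 6 * C + 10 * δ + M * N h))
  obtain ⟨hc, i, hi⟩ := hM x
  set w := h ^ M with hw
  -- Division of `i` by `M`; the remainder adds at most `M * N h` to the length of `b`.
  obtain ⟨q, b, hxb, hb⟩ : ∃ q : ℤ, ∃ b, x = w ^ q * b ∧
      N b ≤ N h + 6 * C + 10 * δ + M * N h := by
    refine ⟨-(i / M), h ^ (-(i % M)) * (h ^ i * x), ?_, ?_⟩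
    · rw [hw, ← zpow_natCast h M, ← zpow_mul, ← mul_assoc, ← mul_assoc, ← zpow_add, ← zpow_add]
      have := Int.mul_ediv_add_emod i M
      rw [show (M : ℤ) * -(i / M) + -(i % M) + i = 0 by linarith, zpow_zero, one_mul]
    · have h1 := hN.mul_le (h ^ (-(i % M))) (h ^ i * x)
      have h0 := Int.emod_nonneg i (b := M) (by omega)
      have h2 := Int.emod_lt_of_pos i (b := M) (by omega)
      lift i % (M : ℤ) to ℕ using h0 with r
      rw [zpow_neg, zpow_natCast] at h1 ⊢
      rw [hN.inv] at h1
      have h3 := hN.pow_le h r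
      have h4 : (r : ℝ) * N h ≤ M * N h :=
        mul_le_mul_of_nonneg_right (by exact_mod_cast h2.le) (hN.nonneg h)
      linarith
  have hcen : w ^ (-q) * b⁻¹ = x⁻¹ := by
    have hcx : Commute x (w ^ q) := hc.zpow_right q
    have : b = (w ^ q)⁻¹ * x := by rw [hxb]; group
    rw [this, zpow_neg, mul_inv_rev, inv_inv, ← mul_assoc, mul_assoc, (hcx.inv_left).eq]
    group
  have key : gp N (w ^ (-q)) (w ^ q) ≤ C := by
    rcases Int.eq_nat_or_neg q with ⟨r, rfl | rfl⟩
    · rw [zpow_neg, zpow_natCast, hw, ← pow_mul]; exact hh.gp_le _ _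
    · rw [neg_neg, zpow_neg, zpow_natCast, hw, ← pow_mul, hN.gp_comm]; exact hh.gp_le _ _
  have h1 := hN.gp_mul_right_le x⁻¹ (w ^ q) b
  rw [← hxb, ← hcen, hN.gp_comm _ (w ^ q)] at h1
  have h2 := hN.gp_mul_right_le (w ^ q) (w ^ (-q)) b⁻¹
  rw [hN.gp_comm (w ^ q) (w ^ (-q)), hN.inv] at h2
  rw [← hcen] at hx
  linarith

end IsAxis

/-! ### Choice of `u` and `v` -/

namespace IsHypLength

variable {Γ : Type*} [Group Γ] {N : Γ → ℝ} {δ : ℝ}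

/-- For some `u`, `v`, one of `g`, `gu`, `gv` has little cancellation in its square. -/
theorem exists_sub_le (hN : IsHypLength N δ) (hfin : ∀ r, {g | N g ≤ r}.Finite)
    (hgeo : ∀ n : ℕ, ∃ g h : Γ, N g = n ∧ N h = n ∧ N (g * h) = 2 * n) :
    ∃ u v : Γ, ∃ α : ℝ, ∀ g : Γ, ∃ f ∈ ({g, g * u, g * v} : Set Γ),
      N g ≤ N f - 2 * gp N f⁻¹ f - 2 * δ + α := by
  have hδ := hN.delta_nonneg
  obtain ⟨h, hh⟩ := hN.exists_two_gp_add_lt hgeo (3 * δ)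
  have hax : IsAxis N (gp N h⁻¹ h + 2 * δ) (N h - 2 * gp N h⁻¹ h - 2 * δ) h :=
    ⟨hN.gp_inv_pow_pow_le hh, by linarith, hN.mul_le_pow (by linarith)⟩
  obtain ⟨v, K, hK⟩ := hax.exists_gp_le hN hfin
  set K' := max K 0 + δ + 1 + N h + N v
  have hNh := hN.nonneg h
  have hNv := hN.nonneg v
  have hm := le_max_left K 0
  have hm0 := le_max_right K 0
  refine ⟨h⁻¹, v⁻¹, 2 * K' + 2 * δ + N h + N v, fun g => ?_⟩
  -- For `f = g * u⁻¹`, the inverse `u * g⁻¹` separates early from `g⁻¹`, which stays long with `g`;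
  -- hence it separates early from `g`, and from `f` up to `N u`.
  have aux (u : Γ) (hu : gp N g⁻¹ (u * g⁻¹) ≤ K) (hg : K' < gp N g⁻¹ g) (huK : N u ≤ N h + N v) :
      N g ≤ N (g * u⁻¹) - 2 * gp N (g * u⁻¹)⁻¹ (g * u⁻¹) - 2 * δ +
        (2 * K' + 2 * δ + N h + N v) := by
    have h1 := hN.le_mul g u⁻¹
    rw [hN.inv] at h1
    by_contra! hcon
    have h2 := hN.gp_mul_right_le (g * u⁻¹)⁻¹ g u⁻¹
    rw [mul_inv_rev, inv_inv, hN.inv] at h2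
    rw [mul_inv_rev, inv_inv] at hcon
    have h3 := hN.le_gp (t := max K 0 + δ + 1) (a := g⁻¹) (b := g) (c := u * g⁻¹) (by linarith)
      (by rw [hN.gp_comm]; linarith)
    linarith
  by_cases hg : gp N g⁻¹ g ≤ K'
  · exact ⟨g, by simp, by linarith⟩
  push Not at hg
  rcases hK g⁻¹ with h1 | h1 | h1
  · rw [inv_inv, hN.gp_comm] at h1
    linarith
  · exact ⟨g * h⁻¹, by simp, aux h h1 hg (by linarith)⟩
  · exact ⟨g * v⁻¹, by simp, aux v h1 hg (by linarith)⟩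

end IsHypLength

end HypGroup
namespace HypGroup

open Filter

/-! ### Word length, stable length and translation length -/

variable {Γ : Type*} [Group Γ] {S : Set Γ}

theorem wordNorm_prod_le {l : List Γ} (hl : ∀ x ∈ l, x ∈ S ∨ x⁻¹ ∈ S) :
    wordNorm S l.prod ≤ l.length :=
  Nat.sInf_le ⟨l, hl, rfl, rfl⟩

theorem wordNorm_one : wordNorm S (1 : Γ) = 0 :=
  Nat.le_zero.1 (wordNorm_prod_le (S := S) (l := []) (by simp))

theorem wordNorm_inv_le (hS : Subgroup.closure S = ⊤) (g : Γ) :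
    wordNorm S g⁻¹ ≤ wordNorm S g := by
  obtain ⟨l, hl, hp, hn⟩ := exists_word hS g
  have := wordNorm_prod_le (S := S) (l := (l.map (·⁻¹)).reverse) fun x hx => by
    simp only [List.mem_reverse, List.mem_map] at hx
    obtain ⟨y, hy, rfl⟩ := hx
    simpa [or_comm] using hl y hy
  rw [← List.prod_inv_reverse, hp] at this
  simpa [hn] using this

theorem wordNorm_inv (hS : Subgroup.closure S = ⊤) (g : Γ) : wordNorm S g⁻¹ = wordNorm S g :=
  (wordNorm_inv_le hS g).antisymm (by simpa using wordNorm_inv_le hS g⁻¹)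

theorem finite_wordNorm_le (hfin : S.Finite) (hS : Subgroup.closure S = ⊤) (n : ℕ) :
    {g : Γ | wordNorm S g ≤ n}.Finite := by
  have hT : (S ∪ S⁻¹).Finite := hfin.union hfin.inv
  have hl : {l : List Γ | (∀ x ∈ l, x ∈ S ∪ S⁻¹) ∧ l.length ≤ n}.Finite := by
    have := hT.to_subtype
    refine ((List.finite_length_le (S ∪ S⁻¹ : Set Γ) n).image (List.map (↑))).subset ?_
    rintro l ⟨h1, h2⟩
    lift l to List (S ∪ S⁻¹ : Set Γ) using h1
    exact ⟨l, by simpa using h2, rfl⟩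
  refine (hl.image List.prod).subset fun g hg => ?_
  obtain ⟨l, h1, h2, h3⟩ := exists_word hS g
  exact ⟨l, ⟨fun x hx => by simpa using h1 x hx, by rw [h3]; exact hg⟩, h2⟩

/-- Balls are finite, so there is a shortest word of more than `2 * n` letters; its first two blocks
of `n` letters are `g` and `h`, as subwords of a shortest word are shortest. -/
theorem exists_wordNorm_mul_eq_two_mul [Infinite Γ] (hfin : S.Finite)
    (hS : Subgroup.closure S = ⊤) (n : ℕ) :
    ∃ g h : Γ, wordNorm S g = n ∧ wordNorm S h = n ∧ wordNorm S (g * h) = 2 * n := by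
  obtain ⟨x, hx⟩ : ∃ x : Γ, 2 * n < wordNorm S x := by
    by_contra! hcon
    exact Set.infinite_univ ((finite_wordNorm_le hfin hS (2 * n)).subset fun x _ => hcon x)
  obtain ⟨l, h1, h2, h3⟩ := exists_word hS x
  have hm (i j : ℕ) : wordNorm S ((l.drop i).take j).prod ≤ min j (l.length - i) := by
    have := wordNorm_prod_le (S := S) (l := (l.drop i).take j) fun y hy =>
      h1 y (List.mem_of_mem_drop (List.mem_of_mem_take hy))
    simpa using this
  have a1 := hm 0 n
  have a2 := hm n n
  have a3 := wordNorm_prod_le (S := S) (l := l.drop (2 * n)) fun y hy =>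
    h1 y (List.mem_of_mem_drop hy)
  rw [List.length_drop] at a3
  set g := ((l.drop 0).take n).prod with hg
  set h := ((l.drop n).take n).prod with hh
  have e : g * h * (l.drop (2 * n)).prod = x := by
    rw [hg, hh, List.drop_zero, mul_assoc, two_mul, ← List.drop_drop, List.prod_take_mul_prod_drop,
      List.prod_take_mul_prod_drop, h2]
  have b1 := wordNorm_mul_le hS (g * h) (l.drop (2 * n)).prod
  rw [e] at b1
  have b2 := wordNorm_mul_le hS g h
  exact ⟨g, h, by omega, by omega, by omega⟩

theorem isHypLength (hS : Subgroup.closure S = ⊤) {δ : ℝ} (h : IsDeltaHyperbolic S δ) :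
    IsHypLength (fun g : Γ => (wordNorm S g : ℝ)) δ where
  one := by simp [wordNorm_one]
  inv g := by simp [wordNorm_inv hS]
  mul_le g h := by exact_mod_cast wordNorm_mul_le hS g h
  hyp a b c := by
    have e (a b : Γ) : gromovProduct S 1 a b = gp (fun g : Γ => (wordNorm S g : ℝ)) a b := by
      simp [gromovProduct, gp, wordDist, wordNorm_inv hS]; ring
    simpa only [e] using h a b c

theorem stableLength_nonneg (hS : Subgroup.closure S = ⊤) (g : Γ) : 0 ≤ stableLength S g :=
  ge_of_tendsto' (tendsto_stableLength hS g) fun n => by positivity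

theorem le_stableLength (hS : Subgroup.closure S = ⊤) {g : Γ} {c : ℝ}
    (h : ∀ n : ℕ, n * c ≤ wordNorm S (g ^ n)) : c ≤ stableLength S g := by
  refine ge_of_tendsto (tendsto_stableLength hS g) ?_
  filter_upwards [eventually_gt_atTop 0] with n hn
  rw [le_div_iff₀ (by exact_mod_cast hn), mul_comm]
  exact h n

theorem sub_le_stableLength (hS : Subgroup.closure S = ⊤) {δ : ℝ} (h : IsDeltaHyperbolic S δ)
    (g : Γ) : wordNorm S g - 2 * gp (fun g : Γ => (wordNorm S g : ℝ)) g⁻¹ g - 2 * δ ≤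
      stableLength S g := by
  rcases le_or_gt ((wordNorm S g : ℝ) - 2 * gp (fun g : Γ => (wordNorm S g : ℝ)) g⁻¹ g - 2 * δ) 0
    with h0 | h0
  · exact h0.trans (stableLength_nonneg hS g)
  · exact le_stableLength hS ((isHypLength hS h).mul_le_pow (by linarith))

/-- The lengths of `g ^ n` and of its conjugate differ by at most `2‖η‖`, which vanishes after
division by `n`. -/
theorem stableLength_le_of_conj (hS : Subgroup.closure S = ⊤) (η g : Γ) :
    stableLength S g ≤ wordNorm S (η * g * η⁻¹) := by
  set x := η * g * η⁻¹ with hx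
  have hlim : Tendsto (fun n : ℕ => (wordNorm S x : ℝ) + 2 * wordNorm S η / n) atTop
      (nhds (wordNorm S x + 0)) :=
    tendsto_const_nhds.add (tendsto_const_div_atTop_nhds_zero_nat _)
  rw [add_zero] at hlim
  refine le_of_tendsto_of_tendsto (tendsto_stableLength hS g) hlim ?_
  filter_upwards [eventually_gt_atTop 0] with n hn
  have hn' : (0 : ℝ) < n := by exact_mod_cast hn
  have e : g ^ n = η⁻¹ * x ^ n * η := by rw [hx, conj_pow]; group
  have hpow : wordNorm S (x ^ n) ≤ n * wordNorm S x := by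
    clear hn hn' e
    induction n with
    | zero => simp [wordNorm_one]
    | succ n ih =>
      have := wordNorm_mul_le hS (x ^ n) x
      rw [pow_succ, add_mul, one_mul]; omega
  have h1 := wordNorm_mul_le hS (η⁻¹ * x ^ n) η
  have h2 := wordNorm_mul_le hS η⁻¹ (x ^ n)
  rw [← e] at h1
  rw [wordNorm_inv hS] at h2
  have h3 : (wordNorm S (g ^ n) : ℝ) ≤ n * wordNorm S x + 2 * wordNorm S η := by
    exact_mod_cast (by omega : wordNorm S (g ^ n) ≤ n * wordNorm S x + 2 * wordNorm S η)
  rw [div_le_iff₀ hn', add_mul, div_mul_cancel₀ _ hn'.ne']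
  linarith

theorem exists_wordNorm_conj_eq (S : Set Γ) (g : Γ) :
    ∃ η : Γ, wordNorm S (η * g * η⁻¹) = translationLength S g :=
  Nat.sInf_mem (Set.range_nonempty _)

/-- Word lengths of finite generating sets are Lipschitz equivalent. -/
theorem exists_wordNorm_le_mul {T : Set Γ} (hT : T.Finite) (hTS : Subgroup.closure T = ⊤)
    (hS : Subgroup.closure S = ⊤) : ∃ c : ℕ, 0 < c ∧ ∀ g : Γ, wordNorm S g ≤ c * wordNorm T g := by
  obtain ⟨c, hc⟩ := (hT.image (wordNorm S)).bddAbove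
  refine ⟨c + 1, by omega, fun g => ?_⟩
  obtain ⟨l, h1, h2, h3⟩ := exists_word hTS g
  rw [← h3, ← h2]
  clear h2 h3
  induction l with
  | nil => simp [wordNorm_one]
  | cons x l ih =>
    have hx : wordNorm S x ≤ c := by
      rcases h1 x (by simp) with h | h
      · exact hc ⟨x, h, rfl⟩
      · rw [← wordNorm_inv hS]; exact hc ⟨_, h, rfl⟩
    have := wordNorm_mul_le hS x l.prod
    have := ih fun y hy => h1 y (by simp [hy])
    rw [List.prod_cons, List.length_cons, mul_add]
    omega

theorem exists_wordNorm_le_max_stableLength (hfin : S.Finite) (hgen : Subgroup.closure S = ⊤)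
    (hyp : IsHyperbolic S) : ∃ u v : Γ, ∃ α : ℝ, ∀ g : Γ, (wordNorm S g : ℝ) ≤
      max (stableLength S g) (max (stableLength S (g * u)) (stableLength S (g * v))) + α := by
  rcases finite_or_infinite Γ with hΓ | hΓ
  -- A finite group has no axis, but its word length is bounded.
  · obtain ⟨α, hα⟩ := (Set.finite_range fun g : Γ => (wordNorm S g : ℝ)).bddAbove
    exact ⟨1, 1, α, fun g => (hα ⟨g, rfl⟩).trans
      (le_add_of_nonneg_left (le_max_of_le_left (stableLength_nonneg hgen g)))⟩
  obtain ⟨δ, hδ⟩ := hyp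
  obtain ⟨u, v, α, h⟩ := (isHypLength hgen hδ).exists_sub_le
    (fun r => (finite_wordNorm_le hfin hgen ⌊r⌋₊).subset fun g hg => Nat.le_floor hg)
    (fun n => by
      obtain ⟨g, h, h1, h2, h3⟩ := exists_wordNorm_mul_eq_two_mul hfin hgen n
      exact ⟨g, h, by simp [h1], by simp [h2], by simp [h3]⟩)
  refine ⟨u, v, α, fun g => ?_⟩
  obtain ⟨f, hf, hle⟩ := h g
  refine hle.trans (add_le_add_left ((sub_le_stableLength hgen hδ f).trans ?_) α)
  rcases hf with rfl | rfl | rfl <;> simp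

end HypGroup

theorem proposition4p2p2 {Γ : Type*} [Group Γ] (S : Set Γ) (hfin : S.Finite)
    (hgen : Subgroup.closure S = ⊤) (hyp : HypGroup.IsHyperbolic S) :
    (∃ u v : Γ, ∃ α : ℝ, ∀ g : Γ,
      (HypGroup.wordNorm S g : ℝ) ≤
        3 * max (HypGroup.stableLength S g)
          (max (HypGroup.stableLength S (g * u)) (HypGroup.stableLength S (g * v))) + α) ∧
    HypGroup.HasUProperty Γ := by
  classical
  obtain ⟨u, v, α, h⟩ := HypGroup.exists_wordNorm_le_max_stableLength hfin hgen hyp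
  refine ⟨⟨u, v, α, fun g => (h g).trans ?_⟩,
    ⟨(Subgroup.fg_iff _).2 ⟨S, hgen, hfin⟩⟩, fun T hT hTgen => ?_⟩
  -- The factor 3 only weakens the bound, since stable lengths are nonnegative.
  · have := (HypGroup.stableLength_nonneg hgen g).trans (le_max_left _
      (max (HypGroup.stableLength S (g * u)) (HypGroup.stableLength S (g * v))))
    linarith
  obtain ⟨c, hc, hST⟩ := HypGroup.exists_wordNorm_le_mul hT hTgen hgen
  obtain ⟨c', hc', hTS⟩ := HypGroup.exists_wordNorm_le_mul hfin hgen hTgen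
  refine ⟨{1, u, v}, ⟨1, by simp⟩, c' * c, c' * |α| + 1, by positivity, by positivity,
    fun g => ?_⟩
  have key (f : Γ) (hf : f ∈ ({1, u, v} : Finset Γ)) : HypGroup.stableLength S (g * f) ≤
      c * ({1, u, v} : Finset Γ).sup' ⟨1, by simp⟩
        (fun f => (HypGroup.translationLength T (f * g) : ℝ)) := by
    obtain ⟨η, hη⟩ := HypGroup.exists_wordNorm_conj_eq T (f * g)
    -- The multiplier passes from the right to the left because `f * g` is the conjugate of `g * f`
    -- by `f`.
    have h1 := HypGroup.stableLength_le_of_conj hgen (η * f) (g * f)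
    rw [show η * f * (g * f) * (η * f)⁻¹ = η * (f * g) * η⁻¹ by group] at h1
    have h2 := hST (η * (f * g) * η⁻¹)
    rw [hη] at h2
    have h3 := Finset.le_sup' (fun f => (HypGroup.translationLength T (f * g) : ℝ)) hf
    refine h1.trans (le_trans (by exact_mod_cast h2) (mul_le_mul_of_nonneg_left h3 (by positivity)))
  have h1 : (HypGroup.wordNorm T g : ℝ) ≤ c' * HypGroup.wordNorm S g := by exact_mod_cast hTS g
  have k1 := key 1 (by simp)
  rw [mul_one] at k1
  have h2 := (h g).trans (add_le_add
    (max_le k1 (max_le (key u (by simp)) (key v (by simp)))) (le_abs_self α))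
  have h3 := mul_le_mul_of_nonneg_left h2 (Nat.cast_nonneg (α := ℝ) c')
  rw [mul_add, ← mul_assoc] at h3
  linarith
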